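/- All stacks are stacks of groupoids on the site of topological spaces with open coverings. A map $a:A\to Y$ from a space $A$ to a stack $Y$ is an atlas if it is representable, surjective and admits local sections. A topological groupoid $\mathcal A=(\mathcal A^1\rightrightarrows\mathcal A^0)$ with source $s$ and range $r$ is called separated if its identity map $\mathcal A^0\to\mathcal A^1$ is closed, proper if $(s,r):\mathcal A^1\to\mathcal A^0\times\mathcal A^0$ is proper, étale if $s$ and $r$ are local homeomorphisms, and very proper if it is proper and étale and there is a continuous function $\chi:\mathcal A^0\to[0,1]$ such that $r:\operatorname{supp}(s^*\chi)\to\mathcal A^0$ is proper and $\sum_{\gamma\in r^{-1}(x)}\chi(s(\gamma))=1$ for all $x\in\mathcal A^0$. An orbispace is a stack $Y$ which admits an atlas $A\to Y$ such that the groupoid $A\times_YA\rightrightarrows A$ is very proper, étale and separated. The loop stack $LY$ of a stack $Y$ is given by $(LY)(T)=\operatorname{Hom}(\mathcal L,Y(T))$, where $\mathcal L$ is the category with one object and infinite cyclic automorphism group; so its objects over a space $T$ are the pairs $(u,\phi)$ of an object $u\in Y(T)$ and an automorphism $\phi$ of $u$. Let $G$ be an abelian topological group, and let $\mathcal BG$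 be the stack of (locally trivial) $G$-principal bundles. A $G$-principal bundle over $Y$ is a map of stacks $p:Y\to\mathcal BG$. It induces the map $$h:LY\xrightarrow{\,Lp\,}L\mathcal BG\cong[G/G]\to G,$$ which sends $(u,\phi)\in(LY)(T)$ to the unique continuous function $g:T\to G$ such that the automorphism $p(\phi)$ of the $G$-principal bundle $\pi:P=p(u)\to T$ is given by $p(\phi)(x)=x\cdot g(\pi(x))$ for all $x\in P$. Let $G^\delta$ denote the group $G$ with the discrete topology. **Lemma.** Let $Y$ be an orbispace, let $G$ be an abelian topological group such that for every integer $n\ge1$ the subspace $\{g\in G\mid g^n=1\}\subseteq G$ is discrete, and let $p:Y\to\mathcal BG$ be a $G$-principal bundle over $Y$. Then the induced map $h:LY\to G$ is locally constant, that is, for every space $T$ and every map $w:T\to LY$ the composition $h\circ w:T\to G$ is locally constant; and $h$ factors, up to $2$-isomorphism, as a map of stacks over the canonical map $G^\delta\to G$. -/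

import Mathlib

open CategoryTheory Opposite Bicategory
open scoped CategoryTheory.Pseudofunctor.StrongTrans

universe u

namespace Orbispace

/-! ### Stacks in topological spaces -/

/-- A prestack on the site of topological spaces: a (not necessarily strict) contravariant
`2`-functor to categories. -/
abbrev Prestack := LocallyDiscrete TopCat.{u}ᵒᵖ ⥤ᵖ Cat.{u, u + 1}

/-- The category `Y(T)` of objects of `Y` over the space `T`; by the Yoneda lemma its objects are
the maps `T → Y`. -/
abbrev Sections (Y : Prestack.{u}) (T : TopCat.{u}) : Cat.{u, u + 1} :=
  Y.obj (LocallyDiscrete.mk (op T))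

/-- The pull-back functor `f^* : Y(T) ⥤ Y(S)` along a continuous map `f : S ⟶ T`. -/
abbrev pull (Y : Prestack.{u}) {S T : TopCat.{u}} (f : S ⟶ T) :
    Sections Y T ⥤ Sections Y S :=
  (Y.map f.op.toLoc).toFunctor

/-- A stack in topological spaces: a prestack in groupoids satisfying descent for morphisms and
for objects with respect to open coverings. -/
structure IsTopStack (Y : Prestack.{u}) : Prop where
  isGroupoid : ∀ T : TopCat.{u}, IsGroupoid (Sections Y T)
  isStack : Y.IsStack TopCat.grothendieckTopology.{u}

/-- A space `S ×_Y T` representing the `2`-categorical fibre product of two maps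
`a : S → Y` and `b : T → Y` from spaces to `Y`. For every space `Q`, the
triples `(f, g, ψ)` of maps `f : Q ⟶ S`, `g : Q ⟶ T` and an isomorphism `ψ : f^* a ≅ g^* b` are
in bijection with the maps `Q ⟶ S ×_Y T`. -/
structure FiberProduct (Y : Prestack.{u}) {S T : TopCat.{u}}
    (a : Sections Y S) (b : Sections Y T) where
  space : TopCat.{u}
  fst : space ⟶ S
  snd : space ⟶ T
  iso : (pull Y fst).obj a ≅ (pull Y snd).obj b
  existsUnique_lift : ∀ {Q : TopCat.{u}} (f : Q ⟶ S) (g : Q ⟶ T)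
    (ψ : (pull Y f).obj a ≅ (pull Y g).obj b),
    ∃! h : Q ⟶ space, ∃ (hf : h ≫ fst = f) (hg : h ≫ snd = g),
      Pseudofunctor.LocallyDiscreteOpToCat.pullHom iso.hom h f g hf hg = ψ.hom

/-- The map `f` has a continuous section in a neighbourhood of every point of its target. -/
def HasLocalSections {P T : TopCat.{u}} (f : P ⟶ T) : Prop :=
  ∀ t : T, ∃ U : Set T, IsOpen U ∧ t ∈ U ∧ ∃ s : C(U, P), ∀ x : U, f (s x) = x

/-- A map `a : A → Y` from a space to `Y` is an atlas if it is representable, surjective and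
admits local sections: for every map `t : T → Y` from a space, the fibre product `T ×_Y A` is a
space, and its projection to `T` is surjective and admits local sections. -/
def IsAtlas {Y : Prestack.{u}} {A : TopCat.{u}} (a : Sections Y A) : Prop :=
  ∀ (T : TopCat.{u}) (t : Sections Y T), ∃ P : FiberProduct Y t a,
    Function.Surjective P.fst ∧ HasLocalSections P.fst

/-! ### The groupoid `A ×_Y A ⇒ A` and orbispaces

The conditions on the topological groupoid `A ×_Y A ⇒ A` which define orbispaces involve only its
spaces of objects and morphisms, its source and range maps, and its identity map. -/

namespace FiberProduct

variable {Y : Prestack.{u}} {A : TopCat.{u}} {a : Sections Y A} (R : FiberProduct Y a a)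

/-- The space of morphisms of the groupoid `A ×_Y A ⇒ A` is `R.space`. This is its source map. -/
abbrev source : R.space ⟶ A := R.fst

/-- The range map of the groupoid `A ×_Y A ⇒ A`. -/
abbrev range : R.space ⟶ A := R.snd

/-- The identity map `A ⟶ A ×_Y A` of the groupoid `A ×_Y A ⇒ A`: it classifies the triple
`(𝟙, 𝟙, id)`. -/
noncomputable def unit : A ⟶ R.space :=
  (R.existsUnique_lift (𝟙 A) (𝟙 A) (Iso.refl _)).choose

/-- The groupoid is separated: its identity map is closed. -/
def IsSeparated : Prop := IsClosedMap R.unit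

/-- The groupoid is proper: `(s, r)` is a proper map. -/
def IsProper : Prop := IsProperMap fun γ : R.space => (R.source γ, R.range γ)

/-- The groupoid is étale: source and range are étale maps, that is, local homeomorphisms. -/
def IsEtale : Prop := IsLocalHomeomorph R.source ∧ IsLocalHomeomorph R.range

/-- The groupoid is very proper: it is proper and étale and there is a continuous cut-off
function `χ : A → [0, 1]` such that `r` is proper on the support of `s^* χ`, and
`∑_{r(γ) = x} χ(s(γ)) = 1` for every `x`. -/
def IsVeryProper : Prop :=
  R.IsProper ∧ R.IsEtale ∧ ∃ χ : C(A, ℝ), (∀ x, χ x ∈ Set.Icc (0 : ℝ) 1) ∧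
    IsProperMap (fun γ : tsupport (fun γ : R.space => χ (R.source γ)) => R.range γ) ∧
    ∀ x : A, HasSum (fun γ : {γ : R.space // R.range γ = x} => χ (R.source γ)) 1

end FiberProduct

/-- An orbispace: a stack in topological spaces which admits an atlas `A → Y` such that the
groupoid `A ×_Y A ⇒ A` is very proper, étale and separated. -/
def IsOrbispace (Y : Prestack.{u}) : Prop :=
  IsTopStack Y ∧ ∃ (A : TopCat.{u}) (a : Sections Y A), IsAtlas a ∧
    ∃ R : FiberProduct Y a a, R.IsVeryProper ∧ R.IsEtale ∧ R.IsSeparated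

/-! ### Spaces as stacks -/

/-- The set of continuous maps `T ⟶ Z`, as a discrete category. -/
structure MapCat (T Z : TopCat.{u}) : Type (u + 1) where
  as : T ⟶ Z

namespace MapCat

variable {T Z : TopCat.{u}}

/-- The only morphisms are equalities. -/
instance : Category.{u} (MapCat T Z) where
  Hom x y := ULift (PLift (x.as = y.as))
  id _ := ⟨⟨rfl⟩⟩
  comp e e' := ⟨⟨e.down.down.trans e'.down.down⟩⟩

instance (x y : MapCat T Z) : Subsingleton (x ⟶ y) :=
  inferInstanceAs (Subsingleton (ULift (PLift (x.as = y.as))))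

/-- The morphism given by an equality of maps. -/
def homOfEq {x y : MapCat T Z} (e : x.as = y.as) : x ⟶ y := ⟨⟨e⟩⟩

/-- The isomorphism given by an equality of maps. -/
def isoOfEq {x y : MapCat T Z} (e : x.as = y.as) : x ≅ y where
  hom := homOfEq e
  inv := homOfEq e.symm
  hom_inv_id := Subsingleton.elim _ _
  inv_hom_id := Subsingleton.elim _ _

lemma eq_of_hom {x y : MapCat T Z} (e : x ⟶ y) : x.as = y.as := e.down.down

/-- Precomposition with a map `S ⟶ T`. -/
def precomp {S : TopCat.{u}} (f : S ⟶ T) : MapCat T Z ⥤ MapCat S Z where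
  obj x := ⟨f ≫ x.as⟩
  map e := homOfEq (congrArg (f ≫ ·) (eq_of_hom e))

/-- Postcomposition with a map `Z ⟶ W`. -/
def postcomp {W : TopCat.{u}} (k : Z ⟶ W) : MapCat T Z ⥤ MapCat T W where
  obj x := ⟨x.as ≫ k⟩
  map e := homOfEq (congrArg (· ≫ k) (eq_of_hom e))

/-- Functors with values in a discrete category are isomorphic if they agree on objects. -/
def natIso {C : Type*} [Category* C] {F F' : C ⥤ MapCat T Z}
    (e : ∀ x, (F.obj x).as = (F'.obj x).as) : F ≅ F' :=
  NatIso.ofComponents (fun x => isoOfEq (e x)) (fun _ => Subsingleton.elim _ _)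

end MapCat

/-- Two-morphisms between functors with values in a discrete category are unique. -/
lemma MapCat.twoHom_eq {C : Cat.{u, u + 1}} {T Z : TopCat.{u}} {F F' : C ⟶ Cat.of (MapCat T Z)}
    (η θ : F ⟶ F') : η = θ := by
  ext x
  exact Subsingleton.elim (α := ULift (PLift (_ = _))) _ _

/-- The stack represented by a space `Z`: its value on `T` is the set of continuous maps `T ⟶ Z`,
considered as a discrete category. -/
def spaceStack (Z : TopCat.{u}) : Prestack.{u} :=
  LocallyDiscrete.mkPseudofunctor
    (fun T => Cat.of (MapCat T.unop Z))
    (fun f => (MapCat.precomp f.unop).toCatHom)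
    (fun _ => Cat.Hom.isoMk (MapCat.natIso fun _ => Category.id_comp _))
    (fun _ _ => Cat.Hom.isoMk (MapCat.natIso fun _ => Category.assoc _ _ _))
    (fun _ _ _ => MapCat.twoHom_eq _ _)
    (fun _ => MapCat.twoHom_eq _ _)
    (fun _ => MapCat.twoHom_eq _ _)

/-- A continuous map of spaces, considered as a map of stacks. -/
def spaceStackMap {Z W : TopCat.{u}} (k : Z ⟶ W) : spaceStack Z ⟶ spaceStack W where
  app T := (MapCat.postcomp (T := T.as.unop) k).toCatHom
  naturality _ := Cat.Hom.isoMk (MapCat.natIso fun _ => Category.assoc _ _ _)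
  naturality_naturality _ := MapCat.twoHom_eq _ _
  naturality_id _ := MapCat.twoHom_eq _ _
  naturality_comp _ _ := MapCat.twoHom_eq _ _

/-- For a map `h : X → Z` from a prestack to a space and an object `w : T → X` of `X(T)`, this is
the continuous map `h ∘ w : T → Z`. -/
def evalMap {X : Prestack.{u}} {Z : TopCat.{u}} (h : X ⟶ spaceStack Z) {T : TopCat.{u}}
    (w : Sections X T) : T ⟶ Z :=
  ((h.app (LocallyDiscrete.mk (op T))).toFunctor.obj w : MapCat T Z).as

/-- A map from a prestack to a space is locally constant if its composition with every
map `w : T → X` from a space is locally constant. -/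
def IsLocallyConstantMap {X : Prestack.{u}} {Z : TopCat.{u}} (h : X ⟶ spaceStack Z) : Prop :=
  ∀ (T : TopCat.{u}) (w : Sections X T), IsLocallyConstant (evalMap h w)

/-! ### Principal bundles and the classifying stack -/

section PrincipalBundle

variable (G : Type u) [Group G] [TopologicalSpace G]

/-- A (locally trivial) `G`-principal bundle over the space `T`, with `G` acting from the right. -/
structure PrincipalBundle (T : TopCat.{u}) : Type (u + 1) where
  total : Type u
  [top : TopologicalSpace total]
  proj : C(total, T)
  act : total → G → total
  continuous_act : Continuous fun p : total × G => act p.1 p.2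
  act_one : ∀ x, act x 1 = x
  act_mul : ∀ x g g', act x (g * g') = act (act x g) g'
  locallyTrivial : ∀ t : T, ∃ U : Set T, IsOpen U ∧ t ∈ U ∧ ∃ e : (U × G) ≃ₜ (proj ⁻¹' U),
    ∀ u g, proj (e (u, g)) = u ∧ ∀ g', act (e (u, g)) g' = e (u, g * g')

namespace PrincipalBundle

attribute [instance] PrincipalBundle.top

variable {G} {T : TopCat.{u}}

/-- A morphism of `G`-principal bundles over `T`: an equivariant continuous map over `T`
(such a map is automatically a homeomorphism). -/
@[ext]
structure Hom (P Q : PrincipalBundle G T) where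
  toMap : C(P.total, Q.total)
  proj_eq : ∀ x, Q.proj (toMap x) = P.proj x
  act_eq : ∀ x g, toMap (P.act x g) = Q.act (toMap x) g

instance : Category.{u} (PrincipalBundle G T) where
  Hom P Q := Hom P Q
  id P := ⟨ContinuousMap.id _, fun _ => rfl, fun _ _ => rfl⟩
  comp φ ψ := ⟨ψ.toMap.comp φ.toMap, fun x => (ψ.proj_eq _).trans (φ.proj_eq x),
    fun x g => (congrArg ψ.toMap (φ.act_eq x g)).trans (ψ.act_eq _ g)⟩

@[ext]
lemma hom_ext {P Q : PrincipalBundle G T} {φ ψ : P ⟶ Q} (h : ∀ x, φ.toMap x = ψ.toMap x) :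
    φ = ψ :=
  Hom.ext (ContinuousMap.ext h)

@[simp] lemma id_toMap (P : PrincipalBundle G T) (x : P.total) : (𝟙 P : P ⟶ P).toMap x = x := rfl

@[simp] lemma comp_toMap {P Q R : PrincipalBundle G T} (φ : P ⟶ Q) (ψ : Q ⟶ R) (x : P.total) :
    (φ ≫ ψ).toMap x = ψ.toMap (φ.toMap x) := rfl

lemma proj_act (P : PrincipalBundle G T) (x : P.total) (g : G) : P.proj (P.act x g) = P.proj x := by
  obtain ⟨U, -, hU, e, he⟩ := P.locallyTrivial (P.proj x)
  obtain ⟨⟨u, k⟩, hk⟩ := e.surjective ⟨x, hU⟩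
  have hx : x = e (u, k) := by rw [hk]
  rw [hx, (he u k).2 g, (he _ _).1, (he _ _).1]

/-- The pull-back of a `G`-principal bundle along a continuous map. -/
def pullback {S : TopCat.{u}} (f : S ⟶ T) (P : PrincipalBundle G T) : PrincipalBundle G S where
  total := {y : S × P.total // f y.1 = P.proj y.2}
  proj := ⟨fun y => y.1.1, by fun_prop⟩
  act y g := ⟨(y.1.1, P.act y.1.2 g), y.2.trans (P.proj_act _ _).symm⟩
  continuous_act := by
    have := P.continuous_act
    refine Continuous.subtype_mk (Continuous.prodMk (by fun_prop) ?_) _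
    exact this.comp (f := fun p : {y : S × P.total // f y.1 = P.proj y.2} × G => (p.1.1.2, p.2))
      (by fun_prop)
  act_one y := Subtype.ext (Prod.ext rfl (P.act_one _))
  act_mul y g g' := Subtype.ext (Prod.ext rfl (P.act_mul _ _ _))
  locallyTrivial s := by
    obtain ⟨U, hUo, hU, e, he⟩ := P.locallyTrivial (f s)
    refine ⟨f ⁻¹' U, hUo.preimage f.hom.continuous, hU, ?_⟩
    have hm (y : {y : S × P.total // f y.1 = P.proj y.2}) (hy : f y.1.1 ∈ U) :
        P.proj y.1.2 ∈ U := y.2 ▸ hy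
    have hp (q : U × G) : P.proj (e q) = q.1 := (he q.1 q.2).1
    have hs (x : P.proj ⁻¹' U) : ((e.symm x).1 : T) = P.proj x := by
      rw [← hp, e.apply_symm_apply]
    refine ⟨{ toFun := fun q => ⟨⟨(q.1.1, (e (⟨f q.1.1, q.1.2⟩, q.2) : P.total)),
                (hp (⟨f q.1.1, q.1.2⟩, q.2)).symm⟩, q.1.2⟩
              invFun := fun y => (⟨y.1.1.1, y.2⟩, (e.symm ⟨y.1.1.2, hm y.1 y.2⟩).2)
              left_inv := fun q => ?_
              right_inv := fun y => ?_
              continuous_toFun := ?_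
              continuous_invFun := ?_ }, fun u g => ⟨rfl, fun g' => ?_⟩⟩
    · have hq := congrArg Prod.snd (e.symm_apply_apply (⟨f q.1.1, q.1.2⟩, q.2))
      exact Prod.ext rfl hq
    · refine Subtype.ext (Subtype.ext (Prod.ext rfl ?_))
      have hq : ((⟨f y.1.1.1, y.2⟩, (e.symm ⟨y.1.1.2, hm y.1 y.2⟩).2) : U × G) =
          e.symm ⟨y.1.1.2, hm y.1 y.2⟩ :=
        Prod.ext (Subtype.ext (y.1.2.trans (hs ⟨y.1.1.2, hm y.1 y.2⟩).symm)) rfl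
      change ((e (⟨f y.1.1.1, y.2⟩, (e.symm ⟨y.1.1.2, hm y.1 y.2⟩).2) : P.proj ⁻¹' U) : P.total) = _
      rw [hq, e.apply_symm_apply]
    · refine Continuous.subtype_mk (Continuous.subtype_mk (Continuous.prodMk (by fun_prop) ?_) _) _
      have h1 : Continuous fun q : (f ⁻¹' U) × G => ((⟨f q.1.1, q.1.2⟩, q.2) : U × G) :=
        Continuous.prodMk (Continuous.subtype_mk (by fun_prop) _) (by fun_prop)
      exact continuous_subtype_val.comp (e.continuous.comp h1)
    · refine Continuous.prodMk (Continuous.subtype_mk (by fun_prop) _) ?_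
      exact continuous_snd.comp (e.symm.continuous.comp (Continuous.subtype_mk (by fun_prop) _))
    · exact Subtype.ext (Prod.ext rfl ((he ⟨f u, u.2⟩ g).2 g'))

/-- The pull-back of a morphism of principal bundles. -/
def pullbackHom {S : TopCat.{u}} (f : S ⟶ T) {P Q : PrincipalBundle G T} (φ : P ⟶ Q) :
    pullback f P ⟶ pullback f Q where
  toMap := ⟨fun y => ⟨(y.1.1, φ.toMap y.1.2), y.2.trans (φ.proj_eq _).symm⟩, by fun_prop⟩
  proj_eq _ := rfl
  act_eq _ _ := Subtype.ext (Prod.ext rfl (φ.act_eq _ _))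

/-- The pull-back functor on principal bundles. -/
def pullbackFunctor {S : TopCat.{u}} (f : S ⟶ T) : PrincipalBundle G T ⥤ PrincipalBundle G S where
  obj := pullback f
  map := pullbackHom f

/-- The canonical isomorphism `𝟙^* P ≅ P`. -/
def pullbackId (P : PrincipalBundle G T) : pullback (𝟙 T) P ≅ P where
  hom := ⟨⟨fun y => y.1.2, by fun_prop⟩, fun y => y.2.symm, fun _ _ => rfl⟩
  inv := ⟨⟨fun x => ⟨(P.proj x, x), rfl⟩, by fun_prop⟩, fun _ => rfl,
    fun x g => Subtype.ext (Prod.ext (P.proj_act x g) rfl)⟩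
  hom_inv_id := hom_ext fun y => Subtype.ext (Prod.ext y.2.symm rfl)
  inv_hom_id := rfl

/-- The canonical isomorphism `(g ∘ f)^* P ≅ f^* g^* P`. -/
def pullbackComp {R S : TopCat.{u}} (f : R ⟶ S) (g : S ⟶ T) (P : PrincipalBundle G T) :
    pullback (f ≫ g) P ≅ pullback f (pullback g P) where
  hom := ⟨⟨fun y => ⟨(y.1.1, ⟨(f y.1.1, y.1.2), y.2⟩), rfl⟩, by
    refine Continuous.subtype_mk (Continuous.prodMk (by fun_prop) ?_) _
    exact Continuous.subtype_mk (by fun_prop) _⟩, fun _ => rfl, fun _ _ => rfl⟩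
  inv := ⟨⟨fun y => ⟨(y.1.1, y.1.2.1.2), (congrArg g y.2).trans y.1.2.2⟩, by fun_prop⟩,
    fun _ => rfl, fun _ _ => rfl⟩
  hom_inv_id := rfl
  inv_hom_id := hom_ext fun y => Subtype.ext (Prod.ext rfl (Subtype.ext (Prod.ext y.2 rfl)))

end PrincipalBundle

open PrincipalBundle in
/-- The classifying stack `𝓑 G`: its value on `T` is the category of `G`-principal bundles
over `T`. -/
def classifyingStack : Prestack.{u} :=
  LocallyDiscrete.mkPseudofunctor
    (fun T => Cat.of (PrincipalBundle G T.unop))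
    (fun f => (pullbackFunctor f.unop).toCatHom)
    (fun _ => Cat.Hom.isoMk (NatIso.ofComponents pullbackId (fun _ => rfl)))
    (fun f g => Cat.Hom.isoMk (NatIso.ofComponents (pullbackComp g.unop f.unop) (fun _ => rfl)))
    (fun _ _ _ => rfl)
    (fun _ => rfl)
    (fun _ => rfl)

end PrincipalBundle

/-! ### Loop stacks -/

/-- The category `𝓛` with one object and infinite cyclic automorphism group. -/
abbrev LoopShape : Type := SingleObj (Multiplicative ℤ)

/-- The generator `σ` of the automorphism group of the object of `𝓛`. -/
def LoopShape.generator : SingleObj.star (Multiplicative ℤ) ⟶ SingleObj.star (Multiplicative ℤ) :=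
  Multiplicative.ofAdd (1 : ℤ)

/-- The loop category `Hom(𝓛, C)` of a category `C`. -/
abbrev loopCat (C : Cat.{u, u + 1}) : Cat.{u, u + 1} := Cat.of (LoopShape ⥤ C)

/-- The functor on loop categories given by composition with a functor. -/
abbrev loopCatMap {C D : Cat.{u, u + 1}} (F : C ⟶ D) : loopCat C ⟶ loopCat D :=
  ((Functor.whiskeringRight LoopShape C D).obj F.toFunctor).toCatHom

/-- The two-morphism on loop categories given by a natural transformation. -/
def loopCatMap₂ {C D : Cat.{u, u + 1}} {F F' : C ⟶ D} (η : F ⟶ F') :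
    loopCatMap F ⟶ loopCatMap F' :=
  ((Functor.whiskeringRight LoopShape C D).map η.toNatTrans).toCatHom₂

/-- The isomorphism of functors on loop categories given by an isomorphism of functors. -/
def loopCatIso {C D : Cat.{u, u + 1}} {F F' : C ⟶ D} (η : F ≅ F') :
    loopCatMap F ≅ loopCatMap F' where
  hom := loopCatMap₂ η.hom
  inv := loopCatMap₂ η.inv
  hom_inv_id := (congrArg loopCatMap₂ η.hom_inv_id :)
  inv_hom_id := (congrArg loopCatMap₂ η.inv_hom_id :)

lemma loopCatMap₂_eqToHom {C D : Cat.{u, u + 1}} {F F' : C ⟶ D} (h : F = F') :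
    loopCatMap₂ (eqToHom h) = eqToHom (congrArg loopCatMap h) := by
  subst h; rfl

/-- The loop stack `L Y`: `(L Y)(T) = Hom(𝓛, Y(T))`. -/
def loopStack (Y : Prestack.{u}) : Prestack.{u} :=
  LocallyDiscrete.mkPseudofunctor
    (fun T => loopCat (Y.obj ⟨T⟩))
    (fun f => loopCatMap (Y.map f.toLoc))
    (fun T => loopCatIso (Y.mapId ⟨T⟩))
    (fun f g => loopCatIso (Y.mapComp f.toLoc g.toLoc))
    (fun f g h => by
      have e := Y.map₂_associator f.toLoc g.toLoc h.toLoc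
      rw [Subsingleton.elim (α_ f.toLoc g.toLoc h.toLoc).hom (eqToHom (by simp)),
        PrelaxFunctor.map₂_eqToHom] at e
      exact (congrArg loopCatMap₂ e.symm).trans (loopCatMap₂_eqToHom _))
    (fun f => by
      have e := Y.map₂_left_unitor f.toLoc
      rw [Subsingleton.elim (λ_ f.toLoc).hom (eqToHom (by simp)),
        PrelaxFunctor.map₂_eqToHom] at e
      exact (congrArg loopCatMap₂ e.symm).trans (loopCatMap₂_eqToHom _))
    (fun f => by
      have e := Y.map₂_right_unitor f.toLoc
      rw [Subsingleton.elim (ρ_ f.toLoc).hom (eqToHom (by simp)),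
        PrelaxFunctor.map₂_eqToHom] at e
      exact (congrArg loopCatMap₂ e.symm).trans (loopCatMap₂_eqToHom _))

/-- The map `L p : L X → L Y` induced by a map `p : X → Y`. -/
def loopMap {X Y : Prestack.{u}} (p : X ⟶ Y) : loopStack X ⟶ loopStack Y where
  app T := loopCatMap (p.app T)
  naturality f := loopCatIso (p.naturality f)
  naturality_naturality {a b f g} η := by
    obtain rfl : f = g := obj_ext_of_isDiscrete η
    obtain rfl : η = 𝟙 f := Subsingleton.elim _ _
    rw [PrelaxFunctor.map₂_id, PrelaxFunctor.map₂_id]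
    refine (congrArg (· ≫ (loopCatIso (p.naturality f)).hom)
      (Bicategory.id_whiskerRight (loopCatMap (X.map f)) (loopCatMap (p.app b)))).trans
      (Eq.trans ?_ (congrArg ((loopCatIso (p.naturality f)).hom ≫ ·)
      (Bicategory.whiskerLeft_id (loopCatMap (p.app a)) (loopCatMap (Y.map f)))).symm)
    exact (Category.id_comp (loopCatIso (p.naturality f)).hom).trans
      (Category.comp_id (loopCatIso (p.naturality f)).hom).symm
  naturality_id a := (congrArg loopCatMap₂ (p.naturality_id a) :)
  naturality_comp f g := (congrArg loopCatMap₂ (p.naturality_comp f g) :)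

/-! ### The function on the loop stack induced by a principal bundle -/

section Commutative

variable (G : Type u) [CommGroup G] [TopologicalSpace G]

namespace PrincipalBundle

variable {G} {T : TopCat.{u}}

lemma proj_surjective (P : PrincipalBundle G T) : Function.Surjective P.proj := by
  intro t
  obtain ⟨U, -, hU, e, he⟩ := P.locallyTrivial t
  exact ⟨e (⟨t, hU⟩, 1), (he _ _).1⟩

lemma act_left_injective (P : PrincipalBundle G T) (x : P.total) {g g' : G}
    (h : P.act x g = P.act x g') : g = g' := by
  obtain ⟨U, -, hU, e, he⟩ := P.locallyTrivial (P.proj x)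
  obtain ⟨⟨u, k⟩, hk⟩ := e.surjective ⟨x, hU⟩
  have hx : x = e (u, k) := by rw [hk]
  rw [hx, (he u k).2, (he u k).2] at h
  simpa using e.injective (Subtype.ext h)

lemma exists_act_eq (P : PrincipalBundle G T) {x y : P.total} (h : P.proj y = P.proj x) :
    ∃ g, y = P.act x g := by
  obtain ⟨U, -, hU, e, he⟩ := P.locallyTrivial (P.proj x)
  obtain ⟨⟨u, k⟩, hk⟩ := e.surjective ⟨x, hU⟩
  obtain ⟨⟨u', k'⟩, hk'⟩ := e.surjective ⟨y, Set.mem_preimage.2 (h.symm ▸ hU)⟩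
  have hx : x = e (u, k) := by rw [hk]
  have hy : y = e (u', k') := by rw [hk']
  have huu : u' = u := Subtype.ext (by rw [← (he u' k').1, ← (he u k).1, ← hx, ← hy, h])
  refine ⟨k⁻¹ * k', ?_⟩
  rw [hx, hy, (he u k).2, huu, mul_inv_cancel_left]

/-- A self-map `φ` of a principal bundle `P` over `T` with abelian structure group is given by
multiplication with a unique continuous function on `T`: `φ(x) = x · g(π(x))`. -/
theorem existsUnique_gauge {P : PrincipalBundle G T} (φ : P ⟶ P) :
    ∃! g : T ⟶ TopCat.of G, ∀ x, φ.toMap x = P.act x (g (P.proj x)) := by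
  have key : ∀ t : T, ∃ k : G, ∀ x, P.proj x = t → φ.toMap x = P.act x k := by
    intro t
    obtain ⟨x₀, hx₀⟩ := P.proj_surjective t
    obtain ⟨k, hk⟩ := P.exists_act_eq (x := x₀) (y := φ.toMap x₀) (φ.proj_eq x₀)
    refine ⟨k, fun x hx => ?_⟩
    obtain ⟨c, rfl⟩ := P.exists_act_eq (x := x₀) (y := x) (hx.trans hx₀.symm)
    rw [φ.act_eq, hk, ← P.act_mul, ← P.act_mul, mul_comm]
  choose k hk using key
  have hcont : Continuous k := by
    refine continuous_iff_continuousAt.2 fun t => ?_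
    obtain ⟨U, hUo, hU, e, he⟩ := P.locallyTrivial t
    have hmem (u : U) : P.proj (φ.toMap (e (u, 1))) ∈ U := by
      rw [φ.proj_eq, (he _ _).1]; exact u.2
    have hc : Continuous fun u : U => (e.symm ⟨φ.toMap (e (u, 1)), hmem u⟩).2 :=
      continuous_snd.comp (e.symm.continuous.comp (Continuous.subtype_mk (by fun_prop) _))
    have heq : (fun u : U => (e.symm ⟨φ.toMap (e (u, 1)), hmem u⟩).2) = fun u : U => k u := by
      funext u
      have h1 := hk u (e (u, 1)) (he u 1).1
      rw [(he u 1).2, one_mul] at h1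
      have h2 : (⟨φ.toMap (e (u, 1)), hmem u⟩ : P.proj ⁻¹' U) = e (u, k u) := Subtype.ext h1
      rw [h2, e.symm_apply_apply]
    rw [heq] at hc
    exact (continuousOn_iff_continuous_domRestrict.2 hc).continuousAt (hUo.mem_nhds hU)
  refine ⟨TopCat.ofHom ⟨k, hcont⟩, fun x => hk _ x rfl, fun g hg => ?_⟩
  ext t
  obtain ⟨x, rfl⟩ := P.proj_surjective t
  exact P.act_left_injective x ((hg x).symm.trans (hk _ x rfl))

/-- The continuous function `g : T → G` with `φ(x) = x · g(π(x))`. -/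
noncomputable def gauge {P : PrincipalBundle G T} (φ : P ⟶ P) : T ⟶ TopCat.of G :=
  (existsUnique_gauge φ).choose

lemma gauge_spec {P : PrincipalBundle G T} (φ : P ⟶ P) (x : P.total) :
    φ.toMap x = P.act x (gauge φ (P.proj x)) :=
  (existsUnique_gauge φ).choose_spec.1 x

lemma gauge_eq {P : PrincipalBundle G T} {φ : P ⟶ P} {g : T ⟶ TopCat.of G}
    (h : ∀ x, φ.toMap x = P.act x (g (P.proj x))) : gauge φ = g :=
  (existsUnique_gauge φ).unique (gauge_spec φ) h

lemma gauge_eq_of_comm {P Q : PrincipalBundle G T} {φ : P ⟶ P} {ψ : Q ⟶ Q} (η : P ⟶ Q)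
    (h : φ ≫ η = η ≫ ψ) : gauge φ = gauge ψ := by
  ext t
  obtain ⟨x, rfl⟩ := P.proj_surjective t
  have hx : η.toMap (φ.toMap x) = ψ.toMap (η.toMap x) := congrArg (fun χ => χ.toMap x) h
  rw [gauge_spec φ, gauge_spec ψ, η.act_eq, η.proj_eq] at hx
  exact Q.act_left_injective _ hx

lemma gauge_pullbackHom {S : TopCat.{u}} (f : S ⟶ T) {P : PrincipalBundle G T} (φ : P ⟶ P) :
    gauge (pullbackHom f φ) = f ≫ gauge φ :=
  gauge_eq fun y => Subtype.ext (Prod.ext rfl ((gauge_spec φ y.1.2).trans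
    (congrArg (fun t => P.act y.1.2 (gauge φ t)) y.2.symm)))

/-- The functor which sends a pair `(P, φ)` of a `G`-principal bundle over `T` and an
automorphism `φ` to the function `g : T → G` such that `φ(x) = x · g(π(x))`. -/
noncomputable def loopGauge (T : TopCat.{u}) :
    (LoopShape ⥤ PrincipalBundle G T) ⥤ MapCat T (TopCat.of G) where
  obj F := ⟨gauge (F.map LoopShape.generator)⟩
  map η := MapCat.homOfEq (gauge_eq_of_comm (η.app _) (η.naturality _))

end PrincipalBundle

/-- The canonical map `L 𝓑 G → G` for an abelian topological group `G`. It is the composition of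
the equivalence `L 𝓑 G ≅ [G / G]`, where `G` acts on itself by conjugation and hence trivially,
with the projection `[G / G] → G`. -/
noncomputable def loopClassifyingMap : loopStack (classifyingStack G) ⟶ spaceStack (TopCat.of G) where
  app T := (PrincipalBundle.loopGauge T.as.unop).toCatHom
  naturality f := Cat.Hom.isoMk (MapCat.natIso fun F =>
    PrincipalBundle.gauge_pullbackHom f.as.unop (F.map LoopShape.generator))
  naturality_naturality _ := MapCat.twoHom_eq _ _
  naturality_id _ := MapCat.twoHom_eq _ _
  naturality_comp _ _ := MapCat.twoHom_eq _ _

variable {G}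

/-- The map `h : L Y → G` induced by a `G`-principal bundle `p : Y → 𝓑 G` over `Y`: the composition
of `L p : L Y → L 𝓑 G` with the canonical map `L 𝓑 G → G`. -/
noncomputable def loopFunction {Y : Prestack.{u}} (p : Y ⟶ classifyingStack G) :
    loopStack Y ⟶ spaceStack (TopCat.of G) :=
  loopMap p ≫ loopClassifyingMap G

end Commutative

/-- The canonical map `G^δ → G`, where `G^δ` is the set `G` with the discrete topology. -/
def fromDiscrete (G : Type u) [TopologicalSpace G] : TopCat.discrete.obj G ⟶ TopCat.of G :=
  @TopCat.ofHom G G ⊥ _ (@ContinuousMap.mk G G ⊥ _ id continuous_bot)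

end Orbispace

open Orbispace

/-! Points of an orbispace have finite automorphism groups, and this finiteness spreads to a
neighbourhood. Let `φ` be an automorphism of `x` in `Y(T)` with associated function `g : T → G`.
Near a point `t₀` the atlas has a local section, so `x` becomes isomorphic to a pullback `f^* a`,
and `φ` to an automorphism `ψ` of it. Each power of `ψ` is classified by a map `Φ k` into the space
of arrows of `A ×_Y A ⇒ A` lying over `(f, f)`. The values `Φ k t₀` lie in a fibre of `(s, r)`,
which is finite as the groupoid is proper and étale; hence `Φ i t₀ = Φ k t₀` for some `i < k`. Both
maps lift `f` along the local homeomorphism `s`, so they agree near `t₀`. There `ψ ^ i = ψ ^ k`,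
hence `g ^ (k - i) = 1` (`exists_pow_eq_pow`, `eventually_loopGaugeOf_pow_eq_one`). A continuous
function with values in a discrete torsion subspace is locally constant.

The factorization is then formal: maps into a space form a discrete category, so a map of stacks to
`G` lifts to `G^δ` once its values are locally constant, all coherence being automatic. -/

namespace Orbispace

open CategoryTheory.Pseudofunctor.LocallyDiscreteOpToCat Filter Topology

/-! ### Point-set topology: finite fibres, unique local lifting, discrete torsion -/

section Topological

/-- The fibres of a proper map `(s, r)` are finite if `s` is a local homeomorphism. -/
lemma finite_fiber_of_isProperMap {X A B : Type*} [TopologicalSpace X] [TopologicalSpace A]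
    [TopologicalSpace B] {s : X → A} {r : X → B} (hs : IsLocalHomeomorph s)
    (h : IsProperMap fun x => (s x, r x)) (a : A) (b : B) :
    {x | s x = a ∧ r x = b}.Finite := by
  have hc : IsCompact ((fun x => (s x, r x)) ⁻¹' {(a, b)}) := h.isCompact_preimage isCompact_singleton
  have he : (fun x => (s x, r x)) ⁻¹' {(a, b)} = {x | s x = a ∧ r x = b} := by
    ext x; simp
  rw [he] at hc
  -- The fibre is compact; it is also discrete, because the local homeomorphism `s` maps it into a
  -- single point.
  refine hc.finite ((hs.isLocalHomeomorphOn (s := _)).isDiscrete_of_image ?_)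
  refine Set.Subsingleton.isDiscrete ?_
  rintro _ ⟨x, hx, rfl⟩ _ ⟨y, hy, rfl⟩
  exact hx.1.trans hy.1.symm

/-- Two continuous lifts along a locally injective map which agree at a point agree near it. -/
lemma eventually_eq_of_comp_eq {X A S : Type*} [TopologicalSpace X] [TopologicalSpace S]
    {s : X → A} (hs : IsLocallyInjective s) {F F' : S → X} (hF : Continuous F)
    (hF' : Continuous F') (h : ∀ t, s (F t) = s (F' t)) {t₀ : S} (h₀ : F t₀ = F' t₀) :
    ∀ᶠ t in 𝓝 t₀, F t = F' t := by
  obtain ⟨U, hU, hm, hinj⟩ := hs (F t₀)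
  filter_upwards [hF.continuousAt.preimage_mem_nhds (hU.mem_nhds hm),
    hF'.continuousAt.preimage_mem_nhds (hU.mem_nhds (h₀ ▸ hm))] with t ht ht'
  exact hinj ht ht' (h t)

/-- A continuous function with values in a group which satisfies `g ^ n = 1` near a point is
constant near this point if the solutions of this equation form a discrete set. -/
lemma eventually_eq_of_pow_eq_one {T G : Type*} [TopologicalSpace T] [Group G]
    [TopologicalSpace G] {n : ℕ} (hG : DiscreteTopology {g : G | g ^ n = 1}) {g : T → G}
    (hg : Continuous g) {t₀ : T} (h : ∀ᶠ t in 𝓝 t₀, g t ^ n = 1) :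
    ∀ᶠ t in 𝓝 t₀, g t = g t₀ := by
  -- `O` is an open subset of `G` that isolates `g t₀` among the solutions of the equation.
  obtain ⟨O, hO, hOe⟩ := isOpen_induced_iff.1
    (isOpen_discrete ({⟨g t₀, h.self_of_nhds⟩} : Set {g : G | g ^ n = 1}))
  have h₀ : g t₀ ∈ O := by
    have : (⟨g t₀, h.self_of_nhds⟩ : {g : G | g ^ n = 1}) ∈ Subtype.val ⁻¹' O := by
      rw [hOe]; rfl
    exact this
  filter_upwards [h, hg.continuousAt.preimage_mem_nhds (hO.mem_nhds h₀)] with t ht htO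
  have : (⟨g t, ht⟩ : {g : G | g ^ n = 1}) ∈ Subtype.val ⁻¹' O := htO
  rw [hOe] at this
  exact congrArg Subtype.val this

end Topological

/-! ### The function attached to an automorphism: invariance, pullback, powers -/

section Gauge

variable {G : Type u} [CommGroup G] [TopologicalSpace G]

namespace PrincipalBundle

lemma gauge_id_apply {T : TopCat.{u}} (P : PrincipalBundle G T) (t : T) :
    (gauge (𝟙 P) t : G) = 1 := by
  obtain ⟨x, rfl⟩ := P.proj_surjective t
  exact P.act_left_injective x ((gauge_spec (𝟙 P) x).symm.trans (P.act_one x).symm)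

lemma gauge_comp_apply {T : TopCat.{u}} {P : PrincipalBundle G T} (φ ψ : P ⟶ P) (t : T) :
    (gauge (φ ≫ ψ) t : G) = gauge φ t * gauge ψ t := by
  obtain ⟨x, rfl⟩ := P.proj_surjective t
  refine P.act_left_injective x ((gauge_spec (φ ≫ ψ) x).symm.trans ?_)
  rw [comp_toMap, gauge_spec ψ, φ.proj_eq, gauge_spec φ]
  exact (P.act_mul _ _ _).symm

end PrincipalBundle

open PrincipalBundle

variable {Y : Prestack.{u}} (p : Y ⟶ classifyingStack G)

/-- The principal bundle over `T` given by an object of `Y(T)` and a map `Y → 𝓑 G`. -/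
def bundle {T : TopCat.{u}} (x : Sections Y T) : PrincipalBundle G T :=
  (p.app (LocallyDiscrete.mk (op T))).toFunctor.obj x

/-- The morphism of principal bundles over `T` given by a morphism of `Y(T)`. -/
def bundleHom {T : TopCat.{u}} {x y : Sections Y T} (φ : x ⟶ y) : bundle p x ⟶ bundle p y :=
  (p.app (LocallyDiscrete.mk (op T))).toFunctor.map φ

lemma bundleHom_id {T : TopCat.{u}} (x : Sections Y T) : bundleHom p (𝟙 x) = 𝟙 (bundle p x) :=
  (p.app (LocallyDiscrete.mk (op T))).toFunctor.map_id x

lemma bundleHom_comp {T : TopCat.{u}} {x y z : Sections Y T} (φ : x ⟶ y) (ψ : y ⟶ z) :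
    bundleHom p (φ ≫ ψ) = bundleHom p φ ≫ bundleHom p ψ :=
  (p.app (LocallyDiscrete.mk (op T))).toFunctor.map_comp φ ψ

/-- The function `g : T → G` describing the automorphism `p(φ)` of a principal bundle. -/
noncomputable def loopGaugeOf {T : TopCat.{u}} {x : Sections Y T} (φ : x ⟶ x) :
    T ⟶ TopCat.of G :=
  gauge (bundleHom p φ)

/-- Allows `x` to be replaced by a pullback of the atlas object. -/
lemma loopGaugeOf_eq_of_comm {T : TopCat.{u}} {x y : Sections Y T} {φ : x ⟶ x} {ψ : y ⟶ y}
    (η : x ⟶ y) (h : φ ≫ η = η ≫ ψ) : loopGaugeOf p φ = loopGaugeOf p ψ :=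
  gauge_eq_of_comm (bundleHom p η) (by rw [← bundleHom_comp, h, bundleHom_comp])

/-- The naturality 2-cell of `p` intertwines `p(f^* φ)` with `f^* p(φ)`, so both have the same gauge
function. -/
lemma loopGaugeOf_pull {S T : TopCat.{u}} (f : S ⟶ T) {x : Sections Y T} (φ : x ⟶ x) :
    loopGaugeOf p ((pull Y f).map φ) = f ≫ loopGaugeOf p φ :=
  (gauge_eq_of_comm ((p.naturality f.op.toLoc).hom.toNatTrans.app x)
    ((p.naturality f.op.toLoc).hom.toNatTrans.naturality φ)).trans
    (gauge_pullbackHom f (bundleHom p φ))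

lemma loopGaugeOf_pow {T : TopCat.{u}} {x : Sections Y T} (φ : End x) (k : ℕ) (t : T) :
    (loopGaugeOf p (φ ^ k : End x) t : G) = (loopGaugeOf p φ t : G) ^ k := by
  induction k with
  | zero =>
    rw [pow_zero, pow_zero]
    exact (congrArg (fun χ => (gauge χ t : G)) (bundleHom_id p x)).trans (gauge_id_apply _ t)
  | succ k ih =>
    -- Multiplication in `End x` reverses composition, so `φ ^ k * φ` is `φ ≫ φ ^ k`; hence the swap
    -- in `G`.
    rw [pow_succ, pow_succ, ← ih, mul_comm]
    exact (congrArg (fun χ => (gauge χ t : G)) (bundleHom_comp p φ (φ ^ k : End x))).trans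
      (gauge_comp_apply _ _ t)

end Gauge

/-! ### Local finiteness of automorphisms and local constancy -/

section LocallyConstant

variable {Y : Prestack.{u}}

/-- `j^* φ` and `pullHom φ j` differ only by coherence isomorphisms that do not depend on `φ`. -/
lemma pull_map_eq_of_pullHom_eq {S T Q : TopCat.{u}} {x x' : Sections Y T} {f f' : S ⟶ T}
    {φ ψ : (pull Y f).obj x ⟶ (pull Y f').obj x'} (j : Q ⟶ S)
    (h : pullHom φ j (j ≫ f) (j ≫ f') = pullHom ψ j (j ≫ f) (j ≫ f')) :
    (pull Y j).map φ = (pull Y j).map ψ := by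
  rw [map_eq_pullHom φ j _ _ rfl rfl, h, ← map_eq_pullHom ψ j _ _ rfl rfl]

/-- Powers of an automorphism of a pulled back object `f^* a` agree locally. -/
lemma exists_pow_eq_pow {A : TopCat.{u}} {a : Sections Y A} (R : FiberProduct Y a a)
    (hp : R.IsProper) (he : R.IsEtale) {S : TopCat.{u}} (f : S ⟶ A)
    (φ : Aut ((pull Y f).obj a)) (t₀ : S) :
    ∃ i k : ℕ, i < k ∧ ∃ W : Set S, IsOpen W ∧ t₀ ∈ W ∧
      (pull Y (TopCat.ofHom ⟨Subtype.val, continuous_subtype_val⟩ : TopCat.of W ⟶ S)).map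
        (End.of φ.hom ^ i : End _) =
      (pull Y (TopCat.ofHom ⟨Subtype.val, continuous_subtype_val⟩ : TopCat.of W ⟶ S)).map
        (End.of φ.hom ^ k : End _) := by
  have hpow : ∀ k : ℕ, (φ ^ k).hom = (End.of φ.hom ^ k : End _) := by
    intro k
    induction k with
    | zero => rfl
    | succ k ih => rw [pow_succ, pow_succ, ← ih]; rfl
  -- `Φ k` classifies the triple `(f, f, φ ^ k)`.
  choose Φ hf hg hΦ using fun k : ℕ => (R.existsUnique_lift f f (φ ^ k)).exists
  have hfin := finite_fiber_of_isProperMap (s := R.source) (r := R.range) he.1 hp (f t₀) (f t₀)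
  have hsrc (k : ℕ) (t : S) : R.source (Φ k t) = f t := ConcreteCategory.congr_hom (hf k) t
  have hrng (k : ℕ) (t : S) : R.range (Φ k t) = f t := ConcreteCategory.congr_hom (hg k) t
  -- Pigeonhole: infinitely many exponents, finitely many arrows from `f t₀` to itself.
  obtain ⟨i, k, hik, heq⟩ := hfin.exists_lt_map_eq_of_forall_mem (f := fun k => Φ k t₀)
    fun k => Set.mem_ofPred_eq ▸ And.intro (hsrc k t₀) (hrng k t₀)
  obtain ⟨W, hW, hWo, hmem⟩ := eventually_nhds_iff.1 <|
    eventually_eq_of_comp_eq he.1.isLocallyInjective (Φ i).hom.continuous (Φ k).hom.continuous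
      (fun t => (hsrc i t).trans (hsrc k t).symm) heq
  refine ⟨i, k, hik, W, hWo, hmem, ?_⟩
  -- Both powers are pullbacks of the universal isomorphism `R.iso`; over `W` they are pulled back
  -- along the same map.
  rw [← hpow, ← hpow, ← hΦ i, ← hΦ k]
  have hj : (TopCat.ofHom ⟨Subtype.val, continuous_subtype_val⟩ : TopCat.of W ⟶ S) ≫ Φ i =
      (TopCat.ofHom ⟨Subtype.val, continuous_subtype_val⟩ : TopCat.of W ⟶ S) ≫ Φ k := by
    ext t
    exact hW t.1 t.2
  refine pull_map_eq_of_pullHom_eq _ ?_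
  rw [pullHom_pullHom, pullHom_pullHom]
  congr 1

variable {G : Type u} [CommGroup G] [TopologicalSpace G]

/-- Since automorphism groups of points of an orbispace are finite, the function describing the
automorphism `p(φ)` satisfies an equation `g ^ n = 1` near every point. -/
lemma eventually_loopGaugeOf_pow_eq_one (hY : IsOrbispace Y) (p : Y ⟶ classifyingStack G)
    {T : TopCat.{u}} {x : Sections Y T} (φ : x ≅ x) (t₀ : T) :
    ∃ n : ℕ, 1 ≤ n ∧ ∀ᶠ t in 𝓝 t₀, (loopGaugeOf p φ.hom t : G) ^ n = 1 := by
  obtain ⟨hst, A, a, ha, R, hvp, he, -⟩ := hY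
  obtain ⟨P, -, hloc⟩ := ha T x
  obtain ⟨U, hUo, hU, s, hs⟩ := hloc t₀
  let ι : TopCat.of U ⟶ T := TopCat.ofHom ⟨Subtype.val, continuous_subtype_val⟩
  let s' : TopCat.of U ⟶ P.space := TopCat.ofHom s
  have hι : s' ≫ P.fst = ι := by ext t; exact hs t
  have := hst.isGroupoid (TopCat.of U)
  -- The section into `T ×_Y A` pulls the universal isomorphism back to an identification of `x`
  -- over `U` with a pullback of `a`.
  let η : (pull Y ι).obj x ≅ (pull Y (s' ≫ P.snd)).obj a :=
    @asIso _ _ _ _ (pullHom P.iso.hom s' ι (s' ≫ P.snd) hι rfl) (IsGroupoid.all_isIso _)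
  let ψ := η.symm ≪≫ (pull Y ι).mapIso φ ≪≫ η
  have hψ : loopGaugeOf p ψ.hom = ι ≫ loopGaugeOf p φ.hom := by
    rw [← loopGaugeOf_pull]
    refine (loopGaugeOf_eq_of_comm p η.hom ?_).symm
    simp [ψ]
  obtain ⟨i, k, hik, W, hWo, hmem, hW⟩ := exists_pow_eq_pow R hvp.1 he (s' ≫ P.snd) ψ ⟨t₀, hU⟩
  have key : ∀ t ∈ W, (loopGaugeOf p φ.hom t : G) ^ i = (loopGaugeOf p φ.hom t : G) ^ k := by
    intro t ht
    have h1 := congrArg (fun χ => (loopGaugeOf p χ (⟨t, ht⟩ : W) : G)) hW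
    simp only [loopGaugeOf_pull] at h1
    have h2 (m : ℕ) : (loopGaugeOf p (End.of ψ.hom ^ m : End _) t : G) =
        (loopGaugeOf p φ.hom t : G) ^ m :=
      (loopGaugeOf_pow p _ m t).trans
        (congrArg (fun g : G => g ^ m) (ConcreteCategory.congr_hom hψ t))
    exact (h2 i).symm.trans (h1.trans (h2 k))
  -- Cancelling `g ^ i` in `g ^ i = g ^ k` leaves the exponent `k - i`, positive since `i < k`.
  refine ⟨k - i, by lia, ?_⟩
  filter_upwards [(hUo.isOpenMap_subtype_val W hWo).mem_nhds ⟨_, hmem, rfl⟩]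
  rintro _ ⟨t, ht, rfl⟩
  have h := key t ht
  rw [← Nat.sub_add_cancel hik.le, pow_add] at h
  exact left_eq_mul.1 (h.trans (mul_comm _ _))

theorem isLocallyConstantMap_loopFunction (hY : IsOrbispace Y)
    (hG : ∀ n : ℕ, 1 ≤ n → DiscreteTopology {g : G | g ^ n = 1}) (p : Y ⟶ classifyingStack G) :
    IsLocallyConstantMap (loopFunction p) := by
  intro T w
  let v : LoopShape ⥤ Sections Y T := w
  have := hY.1.isGroupoid T
  have hiso : IsIso (v.map LoopShape.generator) := IsGroupoid.all_isIso _
  refine (IsLocallyConstant.iff_eventually_eq _).2 fun t₀ => ?_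
  obtain ⟨n, hn, h⟩ := eventually_loopGaugeOf_pow_eq_one hY p (asIso (v.map LoopShape.generator)) t₀
  -- By definition `evalMap (loopFunction p) w` is the gauge function of the image of the generator.
  -- The exponent `n` may vary with `t₀`.
  exact eventually_eq_of_pow_eq_one (hG n hn) (evalMap (loopFunction p) w).hom.continuous h

end LocallyConstant

/-! ### Lifting locally constant maps to the discrete group -/

section Factorization

variable {X : Prestack.{u}} {G : Type u} [TopologicalSpace G]

/-- A locally constant continuous map, considered as a continuous map to the discrete space. -/
def liftDiscrete {T : TopCat.{u}} (g : T ⟶ TopCat.of G) (hg : IsLocallyConstant g) :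
    T ⟶ TopCat.discrete.obj G :=
  @TopCat.ofHom T G _ ⊥ (@ContinuousMap.mk T G _ ⊥ g (@IsLocallyConstant.continuous _ _ _ ⊥ _ hg))

lemma evalMap_eq_of_hom {Z : TopCat.{u}} (h : X ⟶ spaceStack Z) {T : TopCat.{u}}
    {x y : Sections X T} (φ : x ⟶ y) : evalMap h x = evalMap h y :=
  MapCat.eq_of_hom ((h.app (LocallyDiscrete.mk (op T))).toFunctor.map φ)

/-- The naturality 2-cell of `h` lives in a discrete category, so it is an equality of maps. -/
lemma evalMap_pull {Z : TopCat.{u}} (h : X ⟶ spaceStack Z) {S T : TopCat.{u}} (f : S ⟶ T)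
    (x : Sections X T) : evalMap h ((pull X f).obj x) = f ≫ evalMap h x :=
  MapCat.eq_of_hom ((h.naturality f.op.toLoc).hom.toNatTrans.app x)

/-- The lift of a locally constant map `X → G` to `G^δ`. -/
def liftToDiscrete (h : X ⟶ spaceStack (TopCat.of G)) (hh : IsLocallyConstantMap h) :
    X ⟶ spaceStack (TopCat.discrete.obj G) where
  app T := Functor.toCatHom
    { obj := fun x => (⟨liftDiscrete (evalMap h (T := T.as.unop) x) (hh T.as.unop x)⟩ :
        MapCat T.as.unop (TopCat.discrete.obj G))
      map := fun {x y} φ => MapCat.homOfEq (by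
        -- Equality of maps is pointwise, so it transfers from `G` to `G^δ`.
        have e := evalMap_eq_of_hom h (T := T.as.unop) φ
        ext t
        exact ConcreteCategory.congr_hom e t)
      map_id := fun _ => Subsingleton.elim (α := ULift (PLift (_ = _))) _ _
      map_comp := fun _ _ => Subsingleton.elim (α := ULift (PLift (_ = _))) _ _ }
  naturality {S T} f := Cat.Hom.isoMk (MapCat.natIso fun x => by
    have e := evalMap_pull h f.as.unop x
    ext t
    exact ConcreteCategory.congr_hom e t)
  naturality_naturality _ := MapCat.twoHom_eq _ _
  naturality_id _ := MapCat.twoHom_eq _ _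
  naturality_comp _ _ := MapCat.twoHom_eq _ _

/-- The lift to `G^δ` recovers the given map after composition with `G^δ → G`. -/
def liftToDiscreteIso (h : X ⟶ spaceStack (TopCat.of G)) (hh : IsLocallyConstantMap h) :
    liftToDiscrete h hh ≫ spaceStackMap (fromDiscrete G) ≅ h :=
  Pseudofunctor.StrongTrans.isoMk
    (fun _ => Cat.Hom.isoMk (MapCat.natIso fun _ => rfl))
    (fun _ => MapCat.twoHom_eq _ _)

end Factorization

end Orbispace

theorem mainTheorem10 (Y : Prestack.{u}) (hY : IsOrbispace Y)
    (G : Type u) [CommGroup G] [TopologicalSpace G] [IsTopologicalGroup G]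
    (hG : ∀ n : ℕ, 1 ≤ n → DiscreteTopology {g : G | g ^ n = 1})
    (p : Y ⟶ classifyingStack G) :
    IsLocallyConstantMap (loopFunction p) ∧
      ∃ hδ : loopStack Y ⟶ spaceStack (TopCat.discrete.obj G),
        Nonempty (hδ ≫ spaceStackMap (fromDiscrete G) ≅ loopFunction p) := by
  have h := isLocallyConstantMap_loopFunction hY hG p
  exact ⟨h, liftToDiscrete _ h, ⟨liftToDiscreteIso _ h⟩⟩
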